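/- Let $m$ be a natural number and let $X_1,X_2,\dots$ be an i.i.d. source of binary words $\mathbf w_1,\dots,\mathbf w_{2^m}$ of length $m$ with probabilities $P_1\ge P_2\ge\dots\ge P_{2^m}$ and entropy $H=-\sum_i P_i\log_2P_i>0$. Let $\mathbf y_1,\dots,\mathbf y_{2^m}$ be the binary words of length $m$ listed by non-decreasing cost $c_1\le\dots\le c_{2^m}$, where the cost $c(\mathbf y)$ of a word is its number of $0$ symbols. The SLC direct shaping code with this output list keeps a list of all input words with frequency counts, initially in lexicographic order with all counts $0$. An input word in position $k$ of the list, with count $n$, is encoded as $\mathbf y_k$; its count then becomes $n+1$ and it is moved above all words with counts at most $n+1$. A shaping code of block length $q\ge1$ maps successive blocks of $q$ input words to finite strings over the alphabet $\{\mathbf y_1,\dots,\mathbf y_{2^m}\}$, where the map used for a block may depend on the preceding blocks and where, given the preceding blocks, the codewords of distinct blocks are not prefixes of each other. It has rate $1$ if the expected length (in symbols of that alphabet) of the encoding of the first $t$ blocks, divided by $tq$, tends to $1$ as $t\to\infty$. Its average cost is the limit, if it exists, as $t\to\infty$, of the expected total cost of the encoding of the first $t$ blocks divided by $tq$. Then the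 direct shaping code is optimal with respect to average cost among rate-$1$ shaping codes, i.e. it is a rate-$1$ shaping code, it has an average cost, and no rate-$1$ shaping code has a smaller average cost, if and only if there is a real $\mu\ge0$ such that $$P_i=\frac{2^{-\mu c_i}}{\sum_j2^{-\mu c_j}}\quad(1\le i\le 2^m)\qquad\text{and}\qquad -\sum_iP_i\log_2P_i=H .$$ -/

import Mathlib

open MeasureTheory ProbabilityTheory Filter Topology

/-! ### Words, dictionaries and direct shaping codes -/

/-- Binary words of length `m`; `true` is the bit 1 and `false` is the bit 0. -/
abbrev Word (m : ℕ) : Type := Fin m → Bool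

/-- The SLC wear cost of a codeword: its number of 0 symbols. -/
def slcCost {m : ℕ} (v : Word m) : ℝ := ((Finset.univ.filter fun j => v j = false).card : ℝ)

/-- All binary words of length `m`, in lexicographic order. -/
def lexWords : (m : ℕ) → List (Word m)
  | 0 => [Fin.elim0]
  | m + 1 => (lexWords m).map (fun v => (Fin.cons false v : Word (m + 1))) ++
      (lexWords m).map (fun v => (Fin.cons true v : Word (m + 1)))

/-- The dynamic list of a dictionary: input words with their frequency counts, most frequent
first. -/
abbrev Dictionary (m : ℕ) : Type := List (Word m × ℕ)

/-- At the start all counts are 0 and the words are ordered lexicographically. -/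
def Dictionary.init (m : ℕ) : Dictionary m := (lexWords m).map fun x => (x, 0)

/-- The position (counted from 0) of the word `x` in the list. -/
def Dictionary.pos {m : ℕ} (D : Dictionary m) (x : Word m) : ℕ :=
  D.findIdx fun p => decide (p.1 = x)

/-- The frequency count of the word `x`. -/
def Dictionary.count {m : ℕ} (D : Dictionary m) (x : Word m) : ℕ :=
  ((D.find? fun p => decide (p.1 = x)).map Prod.snd).getD 0

/-- The update after the input word `x`, of count `n`: its pair becomes `(x, n + 1)` and is moved
above all pairs with counts at most `n + 1`, the other pairs keeping their relative order. -/
def Dictionary.update {m : ℕ} (D : Dictionary m) (x : Word m) : Dictionary m :=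
  let n := D.count x
  let rest := D.filter fun p => decide (p.1 ≠ x)
  rest.filter (fun p => decide (n + 1 < p.2)) ++
    (x, n + 1) :: rest.filter (fun p => decide (p.2 ≤ n + 1))

/-! ### Shaping codes

A shaping encoder maps successive input blocks in `α ^ q` to strings over the output alphabet `β`.
The string chosen for a block may depend on the blocks encoded before (oldest first); a map
`α ^ q → β*` is the case in which it does not. -/

/-- Shaping encoders with block length `q`: the arguments are the list of past blocks and the
current block. -/
abbrev ShapingEncoder (q : ℕ) (α β : Type) : Type :=
  List (Fin q → α) → (Fin q → α) → List β

/-- Given the past, distinct blocks have codewords neither of which is a prefix of the other, so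
that a decoder that knows the past blocks can recover the current one. -/
def ShapingEncoder.PrefixFree {q : ℕ} {α β : Type} (φ : ShapingEncoder q α β) : Prop :=
  ∀ (h : List (Fin q → α)) (b b' : Fin q → α), φ h b <+: φ h b' → b = b'

/-- The `k`-th block of `q` symbols of a sequence. -/
def block {α : Type} (q : ℕ) (x : ℕ → α) (k : ℕ) : Fin q → α := fun j => x (k * q + j)

/-- The output of the encoder on the first `t` blocks of the sequence `x`. -/
def ShapingEncoder.output {q : ℕ} {α β : Type} (φ : ShapingEncoder q α β) (x : ℕ → α) (t : ℕ) :
    List β :=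
  (List.range t).flatMap fun k => φ ((List.range k).map (block q x)) (block q x k)

/-- The expansion factor of the encoder on the source `X` is `f`: the ratio of the expected output
length to the input length tends to `f`. (For a fixed map `α ^ q → β*` and an i.i.d. source this
ratio does not depend on `t ≥ 1`.) -/
def ShapingEncoder.HasExpansionFactor {Ω : Type*} [MeasurableSpace Ω] (ν : Measure Ω)
    {q : ℕ} {α β : Type} (X : ℕ → Ω → α) (φ : ShapingEncoder q α β) (f : ℝ) : Prop :=
  Tendsto (fun t : ℕ =>
    ∫ ω, ((φ.output (fun n => X n ω) t).length : ℝ) / ((t : ℝ) * (q : ℝ)) ∂ν) atTop (𝓝 f)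

/-- The asymptotic expected average cost of the encoder on the source `X` is `C`: the expected cost
of the output (costs of strings are additive) per source symbol tends to `C`. -/
def ShapingEncoder.HasAverageCost {Ω : Type*} [MeasurableSpace Ω] (ν : Measure Ω)
    {q : ℕ} {α β : Type} (X : ℕ → Ω → α) (cost : β → ℝ) (φ : ShapingEncoder q α β) (C : ℝ) :
    Prop :=
  Tendsto (fun t : ℕ =>
    ∫ ω, ((φ.output (fun n => X n ω) t).map cost).sum / ((t : ℝ) * (q : ℝ)) ∂ν) atTop (𝓝 C)

/-- Rate-1 shaping codes for the source `X`: positive block length, prefix-free, and expansion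
factor 1. -/
def ShapingEncoder.IsRateOne {Ω : Type*} [MeasurableSpace Ω] (ν : Measure Ω)
    {q : ℕ} {α β : Type} (X : ℕ → Ω → α) (φ : ShapingEncoder q α β) : Prop :=
  0 < q ∧ φ.PrefixFree ∧ φ.HasExpansionFactor ν X 1

/-- `φ` is a rate-1 shaping code for the source `X` that has an asymptotic expected average cost,
and no rate-1 shaping code, of whatever block length, has a smaller one. -/
def ShapingEncoder.IsOptimalRateOne {Ω : Type*} [MeasurableSpace Ω] (ν : Measure Ω)
    {q : ℕ} {α β : Type} (X : ℕ → Ω → α) (cost : β → ℝ) (φ : ShapingEncoder q α β) : Prop :=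
  φ.IsRateOne ν X ∧ ∃ C : ℝ, φ.HasAverageCost ν X cost C ∧
    ∀ (q' : ℕ) (ψ : ShapingEncoder q' α β) (C' : ℝ),
      ψ.IsRateOne ν X → ψ.HasAverageCost ν X cost C' → C ≤ C'

/-- The SLC direct shaping code with output list `y`: the input word is mapped to the codeword at
the same position of the output list, and the dictionary is then updated. (The dictionary always
lists every word exactly once, so the position is in range and one codeword is put out.) -/
def directShapingCode {m : ℕ} (y : Fin (2 ^ m) → Word m) :
    ShapingEncoder 1 (Word m) (Word m) := fun h b =>
  let D : Dictionary m := h.foldl (fun D b' => D.update (b' 0)) (Dictionary.init m)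
  ((List.ofFn y)[D.pos (b 0)]?).toList

/-- Entropy in bits, with `0 log 0 = 0`. -/
noncomputable def entropyBits {ι : Type} [Fintype ι] (p : ι → ℝ) : ℝ :=
  -∑ i, p i * Real.logb 2 (p i)

/-! The direct code behaves in the long run like the letterwise map sending the `i`-th most probable
word to `y i`. By the strong law of large numbers the counts eventually order the words by
probability, and ties do not affect the expected cost. Its average cost is therefore `∑ P i * c i`
(`directShapingCode_hasAverageCost`).

Sufficiency is a duality bound. Put `Z s = ∑ exp (-(s * c j))`. The letter weights `exp (-(s * c)) /
Z s` sum to 1, so Kraft's and Gibbs' inequalities show that a rate-1 code of average cost `C`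
satisfies `h ≤ s * C + log (Z s)` for every real `s`, where `h` is the source entropy in nats
(`entropy_le_of_hasAverageCost`). If `P` is the Gibbs distribution of parameter `r`, then the direct
code attains equality at `s = r`. This settles `r > 0`; for `r = 0` the bound on `C` comes from
letting `s` decrease to 0 (`gibbs_le_of_isRateOne`).

Necessity is an exchange argument. Swapping the codewords of two blocks in the letterwise code keeps
the rate equal to 1, so optimality forces a more probable block to cost no more
(`cost_le_of_prob_lt`). Applied to long blocks built from two words, this forces `-log P i` to be an
affine function of `c i` (`gibbs_of_exchange`). Positive entropy excludes the point mass, and the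
same exchange then makes all probabilities positive. -/

/-! ### Kraft's and Gibbs' inequalities -/

/-- Kraft's inequality for letters with weights that sum to at most 1. -/
lemma sum_prod_weight_le_one_of_prefixFree {ι β : Type} [Fintype β] [DecidableEq β]
    {Q : β → ℝ} (hQ : ∀ a, 0 ≤ Q a) (hQ1 : ∑ a, Q a ≤ 1) (L : ℕ) (s : Finset ι)
    (f : ι → List β) (hf : ∀ i ∈ s, ∀ j ∈ s, f i <+: f j → i = j)
    (hL : ∀ i ∈ s, (f i).length ≤ L) :
    ∑ i ∈ s, ((f i).map Q).prod ≤ 1 := by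
  induction L generalizing s f with
  | zero =>
    have hsub : ∀ i ∈ s, ∀ j ∈ s, i = j := fun i hi j hj => hf i hi j hj (by
      rw [List.length_eq_zero_iff.1 (Nat.le_zero.1 (hL i hi))]; simp)
    have hnil : ∀ i ∈ s, ((f i).map Q).prod = 1 := fun i hi => by
      rw [List.length_eq_zero_iff.1 (Nat.le_zero.1 (hL i hi))]; simp
    rw [Finset.sum_congr rfl hnil]
    simpa using Finset.card_le_one.2 hsub
  | succ L ih =>
    by_cases h : ∃ i ∈ s, f i = []
    · obtain ⟨i, hi, hi0⟩ := h
      have hs : s = {i} := Finset.eq_singleton_iff_unique_mem.2 ⟨hi, fun j hj =>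
        (hf i hi j hj (by rw [hi0]; simp)).symm⟩
      simp [hs, hi0]
    · push Not at h
      -- With no empty codeword, group by first letter: the tails within a group are again
      -- prefix-free, and shorter.
      rw [← Finset.sum_fiberwise s (fun i => (f i).head?), Fintype.sum_option]
      have h0 : (s.filter fun i => (f i).head? = none) = ∅ := by
        refine Finset.filter_eq_empty_iff.2 fun i hi hh => h i hi (List.head?_eq_none_iff.1 hh)
      rw [h0, Finset.sum_empty, zero_add]
      refine le_trans (Finset.sum_le_sum fun a _ => ?_) hQ1
      have hcons : ∀ i ∈ s.filter (fun i => (f i).head? = some a), f i = a :: (f i).tail := by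
        intro i hi
        exact (List.cons_head?_tail (Finset.mem_filter.1 hi).2).symm
      have hsum : ∑ i ∈ s.filter (fun i => (f i).head? = some a), ((f i).map Q).prod =
          Q a * ∑ i ∈ s.filter (fun i => (f i).head? = some a), ((f i).tail.map Q).prod := by
        rw [Finset.mul_sum]
        refine Finset.sum_congr rfl fun i hi => ?_
        conv_lhs => rw [hcons i hi]
        simp
      rw [hsum]
      refine mul_le_of_le_one_right (hQ a) (ih _ _ ?_ ?_)
      · intro i hi j hj hij
        refine hf i (Finset.mem_filter.1 hi).1 j (Finset.mem_filter.1 hj).1 ?_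
        rw [hcons i hi, hcons j hj]
        exact (List.prefix_cons_inj a).2 hij
      · intro i hi
        have := hL i (Finset.mem_filter.1 hi).1
        simp only [List.length_tail]
        omega

/-- Gibbs' inequality, for a positive subprobability `Q`. -/
lemma sum_mul_log_le_sum_mul_log {ι : Type} [Fintype ι] {p Q : ι → ℝ} (hp : ∀ i, 0 < p i)
    (hp1 : ∑ i, p i = 1) (hQ : ∀ i, 0 < Q i) (hQ1 : ∑ i, Q i ≤ 1) :
    ∑ i, p i * Real.log (Q i) ≤ ∑ i, p i * Real.log (p i) := by
  -- This is `log u ≤ u - 1` at `u = Q i / p i`; the right-hand sides sum to at most 0.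
  have h : ∀ i, p i * Real.log (Q i) - p i * Real.log (p i) ≤ Q i - p i := by
    intro i
    have h1 := Real.log_le_sub_one_of_pos (div_pos (hQ i) (hp i))
    rw [Real.log_div (hQ i).ne' (hp i).ne'] at h1
    have h2 := mul_le_mul_of_nonneg_left h1 (hp i).le
    have h3 : p i * (Q i / p i - 1) = Q i - p i := by
      field_simp [(hp i).ne']
    linarith
  have := Finset.sum_le_sum fun i (_ : i ∈ Finset.univ) => h i
  simp only [Finset.sum_sub_distrib] at this
  linarith

/-! ### Product weights -/

lemma sum_prod_eq_one {α : Type} [Fintype α] [DecidableEq α] {p : α → ℝ} (hp : ∑ x, p x = 1)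
    (q : ℕ) : ∑ b : Fin q → α, ∏ j, p (b j) = 1 := by
  have := Finset.prod_univ_sum (fun _ : Fin q => Finset.univ) (fun (_ : Fin q) x => p x)
  simpa [hp] using this.symm

/-- Additivity of expectation over the letters of a block. It serves both for block entropy (`f =
-log p`) and for the cost of a letterwise code. -/
lemma sum_prod_mul_sum {α : Type} [Fintype α] [DecidableEq α] {p : α → ℝ} (hp : ∑ x, p x = 1)
    (f : α → ℝ) (q : ℕ) :
    ∑ b : Fin q → α, (∏ j, p (b j)) * ∑ j, f (b j) = q * ∑ x, p x * f x := by
  induction q with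
  | zero => simp
  | succ q ih =>
    rw [← (Fin.consEquiv fun _ => α).sum_comp, Fintype.sum_prod_type]
    have h : ∀ (x : α) (v : Fin q → α),
        (∏ j, p ((Fin.consEquiv fun _ => α) (x, v) j)) *
            ∑ j, f ((Fin.consEquiv fun _ => α) (x, v) j) =
          (p x * f x) * ∏ j, p (v j) + p x * ((∏ j, p (v j)) * ∑ j, f (v j)) := by
      intro x v
      simp only [Fin.consEquiv_apply, Fin.prod_univ_succ, Fin.sum_univ_succ, Fin.cons_zero,
        Fin.cons_succ]
      ring
    simp only [h, Finset.sum_add_distrib, ← Finset.mul_sum, ih, sum_prod_eq_one hp]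
    rw [← Finset.sum_mul (s := Finset.univ) (f := p), hp]
    push_cast
    ring_nf

/-! ### The code letters -/

lemma slcCost_nonneg {m : ℕ} (v : Word m) : 0 ≤ slcCost v := Nat.cast_nonneg _

lemma slcCost_le {m : ℕ} (v : Word m) : slcCost v ≤ m := by
  unfold slcCost
  exact_mod_cast (Finset.card_le_univ _).trans (by simp)

lemma slcCost_eq_zero_iff {m : ℕ} (v : Word m) : slcCost v = 0 ↔ v = fun _ => true := by
  unfold slcCost
  rw [Nat.cast_eq_zero, Finset.card_eq_zero, Finset.filter_eq_empty_iff]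
  simp [funext_iff]

/-! ### The dictionary -/

lemma nodup_lexWords (m : ℕ) : (lexWords m).Nodup := by
  induction m with
  | zero => simp [lexWords]
  | succ m ih =>
    refine List.Nodup.append (ih.map (Fin.cons_right_injective (α := fun _ => Bool) _))
      (ih.map (Fin.cons_right_injective (α := fun _ => Bool) _)) ?_
    intro v hv hv'
    obtain ⟨a, -, rfl⟩ := List.mem_map.1 hv
    obtain ⟨b, -, h⟩ := List.mem_map.1 hv'
    simpa using congrFun h 0

lemma mem_lexWords {m : ℕ} (v : Word m) : v ∈ lexWords m := by
  induction m with
  | zero => simp [lexWords, Subsingleton.elim v Fin.elim0]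
  | succ m ih =>
    rw [lexWords, List.mem_append, List.mem_map, List.mem_map]
    cases h : v 0
    · exact Or.inl ⟨Fin.tail v, ih _, by rw [← h]; exact Fin.cons_self_tail v⟩
    · exact Or.inr ⟨Fin.tail v, ih _, by rw [← h]; exact Fin.cons_self_tail v⟩

/-- The dictionary lists every word `x` exactly once, with the count `n x`, and the counts are
non-increasing along the list. -/
structure Dictionary.Represents {m : ℕ} (D : Dictionary m) (n : Word m → ℕ) : Prop where
  nodup : (D.map Prod.fst).Nodup
  mem : ∀ x, (x, n x) ∈ D
  sorted : D.Pairwise fun a b => b.2 ≤ a.2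

namespace Dictionary.Represents

variable {m : ℕ} {D : Dictionary m} {n : Word m → ℕ}

lemma init : (Dictionary.init m).Represents fun _ => 0 where
  nodup := by simpa [Dictionary.init, Function.comp_def] using nodup_lexWords m
  mem x := by simpa [Dictionary.init] using mem_lexWords x
  sorted := by
    rw [Dictionary.init, List.pairwise_map]
    exact List.pairwise_of_forall (by simp)

lemma eq_of_mem (h : D.Represents n) {a : Word m × ℕ} (ha : a ∈ D) : a.2 = n a.1 := by
  have := List.inj_on_of_nodup_map h.nodup ha (h.mem a.1) rfl
  exact congrArg Prod.snd this

lemma count_eq (h : D.Represents n) (x : Word m) : D.count x = n x := by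
  unfold Dictionary.count
  cases hf : D.find? fun p => decide (p.1 = x) with
  | none =>
    have := List.find?_eq_none.1 hf _ (h.mem x)
    simp at this
  | some a =>
    have h1 := List.find?_some hf
    have h2 := h.eq_of_mem (List.mem_of_find?_eq_some hf)
    simp only [decide_eq_true_eq] at h1
    simp [h2, h1]

/-- Up to permutation the new list is the old one with the pair of `x` replaced, which settles
everything except the order. The order survives because a sorted list is cut at the value `n x + 1`
and the new pair is put at the cut. -/
lemma update (h : D.Represents n) (x : Word m) :
    (D.update x).Represents (Function.update n x (n x + 1)) := by
  unfold Dictionary.update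
  simp only [h.count_eq]
  set rest := D.filter fun p => decide (p.1 ≠ x) with hrest
  have hnd : (rest.map Prod.fst).Nodup := h.nodup.sublist (List.filter_sublist.map _)
  have hperm : (rest.filter (fun p => decide (n x + 1 < p.2)) ++
      (x, n x + 1) :: rest.filter (fun p => decide (p.2 ≤ n x + 1))).Perm
      ((x, n x + 1) :: rest) := by
    refine List.perm_middle.trans (List.Perm.cons _ ?_)
    have := List.filter_append_perm (fun p : Word m × ℕ => decide (n x + 1 < p.2)) rest
    simpa [← decide_not, not_lt] using this
  have hsort : rest.Pairwise fun a b => b.2 ≤ a.2 := h.sorted.sublist List.filter_sublist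
  refine ⟨?_, ?_, ?_⟩
  · rw [(hperm.map Prod.fst).nodup_iff, List.map_cons, List.nodup_cons]
    refine ⟨?_, hnd⟩
    simp [hrest]
  · intro z
    rw [hperm.mem_iff]
    by_cases hz : z = x
    · simp [hz]
    · simp [hz, hrest, h.mem z]
  · rw [List.pairwise_append, List.pairwise_cons]
    refine ⟨hsort.sublist List.filter_sublist, ⟨?_, hsort.sublist List.filter_sublist⟩, ?_⟩
    · intro a ha
      simpa using (List.mem_filter.1 ha).2
    · intro a ha b hb
      have h1 : n x + 1 < a.2 := by simpa using (List.mem_filter.1 ha).2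
      rcases List.mem_cons.1 hb with rfl | hb
      · exact h1.le
      · have h2 : b.2 ≤ n x + 1 := by simpa using (List.mem_filter.1 hb).2
        exact h2.trans h1.le

lemma foldl {q : Type*} (g : q → Word m) (h : D.Represents n) (l : List q) :
    (l.foldl (fun D b => D.update (g b)) D).Represents
      fun x => n x + (l.map g).count x := by
  induction l generalizing D n with
  | nil => simpa using h
  | cons a l ih =>
    have := ih (h.update (g a))
    simp only [List.foldl_cons, List.map_cons]
    convert this using 2 with x
    by_cases hx : x = g a
    · subst hx; simp; omega
    · simp [Function.update_of_ne hx, Ne.symm hx]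

lemma length_eq (h : D.Represents n) : D.length = 2 ^ m := by
  have h1 : (D.map Prod.fst).toFinset = Finset.univ :=
    Finset.eq_univ_iff_forall.2 fun x => by
      rw [List.mem_toFinset]; exact List.mem_map.2 ⟨_, h.mem x, rfl⟩
  have h2 := List.toFinset_card_of_nodup h.nodup
  rw [h1] at h2
  simpa using h2.symm

/-- The words in the order of the dictionary; the inverse map is the position. -/
lemma exists_equiv (h : D.Represents n) : ∃ d : Fin (2 ^ m) ≃ Word m,
    (∀ k, D.pos (d k) = k) ∧ ∀ i j, i ≤ j → n (d j) ≤ n (d i) := by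
  have hlen := h.length_eq
  let d : Fin (2 ^ m) → Word m := fun k => (D[k.1]'(by rw [hlen]; exact k.2)).1
  have hinj : Function.Injective d := by
    intro i j hij
    have h1 : (D.map Prod.fst)[i.1]'(by simp [hlen]) = (D.map Prod.fst)[j.1]'(by simp [hlen]) := by
      simpa using hij
    exact Fin.ext ((h.nodup.getElem_inj_iff).1 h1)
  have hbij : Function.Bijective d :=
    (Fintype.bijective_iff_injective_and_card d).2 ⟨hinj, by simp⟩
  refine ⟨Equiv.ofBijective d hbij, fun k => ?_, fun i j hij => ?_⟩
  · have hk : k.1 < D.length := by rw [hlen]; exact k.2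
    unfold Dictionary.pos
    rw [List.findIdx_eq hk]
    refine ⟨by simp [d], fun j hj => ?_⟩
    have : d ⟨j, hj.trans k.2⟩ ≠ d k := fun hc => by
      have := congrArg Fin.val (hinj hc)
      simp only at this
      omega
    simpa [d] using this
  · rcases hij.eq_or_lt with rfl | hlt
    · exact le_rfl
    · have h1 := List.pairwise_iff_getElem.1 h.sorted i.1 j.1 (by rw [hlen]; exact i.2)
        (by rw [hlen]; exact j.2) hlt
      rwa [h.eq_of_mem (List.getElem_mem _), h.eq_of_mem (List.getElem_mem _)] at h1

end Dictionary.Represents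

/-- The word counts of a history. -/
def wordCount {m : ℕ} (h : List (Fin 1 → Word m)) (x : Word m) : ℕ := (h.map (· 0)).count x

/-- After any history, the direct shaping code assigns the output list to the words in some order
of non-increasing counts. -/
lemma directShapingCode_eq {m : ℕ} (y : Fin (2 ^ m) → Word m) (h : List (Fin 1 → Word m)) :
    ∃ d : Fin (2 ^ m) ≃ Word m, (∀ i j, i ≤ j → wordCount h (d j) ≤ wordCount h (d i)) ∧
      ∀ b, directShapingCode y h b = [y (d.symm (b 0))] := by
  have hR := Dictionary.Represents.init (m := m) |>.foldl (fun b : Fin 1 → Word m => b 0) h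
  obtain ⟨d, hd, hs⟩ := hR.exists_equiv
  refine ⟨d, fun i j hij => by simpa [wordCount] using hs i j hij, fun b => ?_⟩
  have hb := hd (d.symm (b 0))
  rw [Equiv.apply_symm_apply] at hb
  simp only [directShapingCode]
  rw [hb]
  simp

/-! ### Expectations over the source -/

/-- The blocks before the `k`-th. -/
def pastBlocks {α : Type} (q : ℕ) (x : ℕ → α) (k : ℕ) : List (Fin q → α) :=
  (List.range k).map (block q x)

/-- For fixed `k` and finite `α` this presents the past as a function of a variable in a finite
type, from which integrability follows. -/
lemma pastBlocks_eq_ofFn {α : Type} (q : ℕ) (x : ℕ → α) (k : ℕ) :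
    pastBlocks q x k = List.ofFn fun i : Fin k => block q x i := by
  rw [pastBlocks, List.ofFn_eq_map, ← List.map_coe_finRange_eq_range, List.map_map]
  rfl

lemma ShapingEncoder.hasExpansionFactor_iff {Ω : Type*} [MeasurableSpace Ω] {ν : Measure Ω}
    {q : ℕ} {α β : Type} {X : ℕ → Ω → α} (φ : ShapingEncoder q α β) (e : ℝ) :
    φ.HasExpansionFactor ν X e ↔ φ.HasAverageCost ν X (fun _ => 1) e := by
  simp [ShapingEncoder.HasExpansionFactor, ShapingEncoder.HasAverageCost]

section Blocks

variable {Ω : Type*} [MeasurableSpace Ω] {ν : Measure Ω} {α : Type} [MeasurableSpace α]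
  {X : ℕ → Ω → α}

lemma measurable_block (hX : ∀ n, Measurable (X n)) (q k : ℕ) :
    Measurable fun ω => block q (fun n => X n ω) k :=
  measurable_pi_lambda _ fun _ => hX _

/-- The past reads the source at indices below `k * q`, the current block at indices from `k * q`
on. -/
lemma indepFun_past_block (hX : ∀ n, Measurable (X n)) (hind : iIndepFun X ν) (q k : ℕ) :
    IndepFun (fun ω => fun i : Fin k => block q (fun n => X n ω) i)
      (fun ω => block q (fun n => X n ω) k) ν := by
  have hdisj : Disjoint (Finset.range (k * q)) (Finset.Ico (k * q) ((k + 1) * q)) := by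
    rw [Finset.disjoint_left]
    intro a ha hb
    simp only [Finset.mem_range, Finset.mem_Ico] at ha hb
    omega
  have h := hind.indepFun_finset _ _ hdisj hX
  have h1 : ∀ (i : Fin k) (j : Fin q), (i : ℕ) * q + j ∈ Finset.range (k * q) := by
    intro i j
    have : (i + 1 : ℕ) * q ≤ k * q := Nat.mul_le_mul_right q i.2
    have := j.2
    rw [Finset.mem_range]
    linarith [add_mul (i : ℕ) 1 q]
  have h2 : ∀ j : Fin q, k * q + (j : ℕ) ∈ Finset.Ico (k * q) ((k + 1) * q) := by
    intro j
    have := j.2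
    rw [Finset.mem_Ico]
    constructor
    · omega
    · linarith [add_mul k 1 q]
  exact h.comp (φ := fun v => fun (i : Fin k) (j : Fin q) => v ⟨i * q + j, h1 i j⟩)
    (ψ := fun v => fun j : Fin q => v ⟨k * q + j, h2 j⟩)
    (measurable_pi_lambda _ fun _ => measurable_pi_lambda _ fun _ => measurable_pi_apply _)
    (measurable_pi_lambda _ fun _ => measurable_pi_apply _)

lemma measureReal_block [MeasurableSingletonClass α] (hind : iIndepFun X ν)
    (hid : ∀ n, IdentDistrib (X n) (X 0) ν ν) (q k : ℕ) (b : Fin q → α) :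
    ν.real ((fun ω => block q (fun n => X n ω) k) ⁻¹' {b}) =
      ∏ j, ν.real (X 0 ⁻¹' {b j}) := by
  have hinj : Function.Injective fun j : Fin q => k * q + (j : ℕ) := by
    intro i j hij
    simp only at hij
    exact Fin.ext (by omega)
  have h := (hind.precomp hinj).meas_iInter (s := fun j : Fin q => X (k * q + j) ⁻¹' {b j})
    (fun j => ⟨{b j}, measurableSet_singleton _, rfl⟩)
  have hset : (fun ω => block q (fun n => X n ω) k) ⁻¹' {b} =
      ⋂ j : Fin q, X (k * q + j) ⁻¹' {b j} := by
    ext ω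
    simp [block, funext_iff]
  rw [measureReal_def, hset, h, ENNReal.toReal_prod]
  refine Finset.prod_congr rfl fun j _ => ?_
  rw [(hid _).measure_mem_eq (measurableSet_singleton _), measureReal_def]

end Blocks

section Source

variable {Ω : Type*} [MeasurableSpace Ω] {ν : Measure Ω} [IsProbabilityMeasure ν]

lemma integrable_comp_of_finite {α : Type*} [Finite α] [MeasurableSpace α]
    [MeasurableSingletonClass α] {A : Ω → α} (hA : Measurable A) (f : α → ℝ) :
    Integrable (fun ω => f (A ω)) ν := by
  have : IsProbabilityMeasure (ν.map A) := Measure.isProbabilityMeasure_map hA.aemeasurable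
  exact (Integrable.of_finite (μ := ν.map A) (f := f)).comp_measurable hA

/-- The expectation of a function of two independent finitely valued variables. -/
lemma integral_eq_sum_of_indepFun {α β : Type*} [Finite α] [MeasurableSpace α]
    [MeasurableSingletonClass α] [Fintype β] [MeasurableSpace β] [MeasurableSingletonClass β]
    {A : Ω → α} {B : Ω → β} (hA : Measurable A) (hB : Measurable B) (hAB : IndepFun A B ν)
    (g : α → β → ℝ) :
    ∫ ω, g (A ω) (B ω) ∂ν = ∑ b, ν.real (B ⁻¹' {b}) * ∫ ω, g (A ω) b ∂ν := by
  classical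
  have h1 : ∀ ω, g (A ω) (B ω) =
      ∑ b, (({b} : Set β).indicator (fun _ => (1 : ℝ)) (B ω)) * g (A ω) b := by
    intro ω
    rw [Finset.sum_eq_single (B ω)]
    · simp
    · intro b _ hb
      simp [Set.indicator, hb.symm]
    · simp
  simp only [h1]
  rw [integral_finsetSum]
  · refine Finset.sum_congr rfl fun b _ => ?_
    have hi : IndepFun (fun ω => ({b} : Set β).indicator (fun _ => (1 : ℝ)) (B ω))
        (fun ω => g (A ω) b) ν :=
      hAB.symm.comp (φ := fun x => ({b} : Set β).indicator (fun _ => (1 : ℝ)) x)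
        (ψ := fun a => g a b) (measurable_of_finite _) (measurable_of_finite _)
    rw [hi.integral_fun_mul_eq_mul_integral]
    · congr 1
      have : (fun ω => ({b} : Set β).indicator (fun _ => (1 : ℝ)) (B ω)) =
          (B ⁻¹' {b}).indicator (fun _ => (1 : ℝ)) := by
        ext ω; simp [Set.indicator]
      rw [this, integral_indicator_const _ (hB (measurableSet_singleton b))]
      simp
    · exact (integrable_comp_of_finite (ν := ν) hB
        (({b} : Set β).indicator fun _ => (1 : ℝ))).aestronglyMeasurable
    · exact (integrable_comp_of_finite hA fun a => g a b).aestronglyMeasurable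
  · intro b _
    exact integrable_comp_of_finite (hA.prodMk hB)
      (fun ab : α × β => ({b} : Set β).indicator (fun _ => (1 : ℝ)) ab.2 * g ab.1 b)

variable {α : Type} [Fintype α] [MeasurableSpace α] [MeasurableSingletonClass α]
  {X : ℕ → Ω → α}

lemma integrable_past_block (hX : ∀ n, Measurable (X n)) (q k : ℕ)
    (g : List (Fin q → α) → (Fin q → α) → ℝ) :
    Integrable (fun ω => g (pastBlocks q (fun n => X n ω) k) (block q (fun n => X n ω) k)) ν := by
  simp only [pastBlocks_eq_ofFn]
  exact integrable_comp_of_finite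
    (A := fun ω => ((fun i : Fin k => block q (fun n => X n ω) i), block q (fun n => X n ω) k))
    ((measurable_pi_lambda _ fun _ => measurable_block hX q _).prodMk (measurable_block hX q k))
    (fun a => g (List.ofFn a.1) a.2)

/-- By independence the current block can be averaged with the past frozen, so a code may be studied
one history at a time. -/
lemma integral_past_block (hX : ∀ n, Measurable (X n)) (hind : iIndepFun X ν)
    (hid : ∀ n, IdentDistrib (X n) (X 0) ν ν) (q k : ℕ)
    (g : List (Fin q → α) → (Fin q → α) → ℝ) :
    ∫ ω, g (pastBlocks q (fun n => X n ω) k) (block q (fun n => X n ω) k) ∂ν =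
      ∫ ω, ∑ b : Fin q → α, (∏ j, ν.real (X 0 ⁻¹' {b j})) *
        g (pastBlocks q (fun n => X n ω) k) b ∂ν := by
  classical
  have hint := fun b => integrable_past_block (ν := ν) hX q k (fun h _ => g h b)
  rw [integral_finsetSum _ fun b _ => (hint b).const_mul _]
  simp only [pastBlocks_eq_ofFn, integral_const_mul]
  rw [integral_eq_sum_of_indepFun (measurable_pi_lambda _ fun _ => measurable_block hX q _)
    (measurable_block hX q k) (indepFun_past_block hX hind q k) (fun a b => g (List.ofFn a) b)]
  simp only [measureReal_block hind hid]

lemma ShapingEncoder.sum_map_output {β : Type} {q : ℕ} {α : Type} (φ : ShapingEncoder q α β)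
    (f : β → ℝ) (x : ℕ → α) (t : ℕ) :
    ((φ.output x t).map f).sum =
      ∑ k ∈ Finset.range t, ((φ (pastBlocks q x k) (block q x k)).map f).sum := by
  unfold ShapingEncoder.output
  induction t with
  | zero => simp
  | succ t ih =>
    rw [List.range_succ, List.flatMap_append, List.map_append, List.sum_append, ih,
      Finset.sum_range_succ]
    simp [pastBlocks]

lemma integrable_output {β : Type} (hX : ∀ n, Measurable (X n)) {q : ℕ}
    (φ : ShapingEncoder q α β) (f : β → ℝ) (t : ℕ) :
    Integrable (fun ω => ((φ.output (fun n => X n ω) t).map f).sum) ν := by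
  simp only [φ.sum_map_output]
  exact integrable_finsetSum _ fun k _ => integrable_past_block hX q k
    (fun h b => ((φ h b).map f).sum)

/-- Used to merge cost and length into the single functional `s * cost + log (Z s)` to which Kraft's
inequality applies. -/
lemma ShapingEncoder.HasAverageCost.linear_combination {β : Type} (hX : ∀ n, Measurable (X n))
    {q : ℕ} {φ : ShapingEncoder q α β} {f g : β → ℝ} {C D : ℝ} (hC : φ.HasAverageCost ν X f C)
    (hD : φ.HasAverageCost ν X g D) (r s : ℝ) :
    φ.HasAverageCost ν X (fun a => r * f a + s * g a) (r * C + s * D) := by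
  refine ((hC.const_mul r).add (hD.const_mul s)).congr fun t => ?_
  have h : ∀ l : List β, (l.map fun a => r * f a + s * g a).sum =
      r * (l.map f).sum + s * (l.map g).sum := by
    intro l
    rw [List.sum_map_add, List.sum_map_mul_left, List.sum_map_mul_left]
  simp only [h, integral_div]
  rw [integral_add ((integrable_output hX φ f t).const_mul r)
    ((integrable_output hX φ g t).const_mul s), integral_const_mul, integral_const_mul]
  ring

/-- The expectation of an additive functional of the output, per source symbol. -/
lemma integral_output_eq {β : Type} (hX : ∀ n, Measurable (X n)) (hind : iIndepFun X ν)
    (hid : ∀ n, IdentDistrib (X n) (X 0) ν ν) {q : ℕ} (φ : ShapingEncoder q α β) (f : β → ℝ)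
    (t : ℕ) :
    ∫ ω, ((φ.output (fun n => X n ω) t).map f).sum / ((t : ℝ) * (q : ℝ)) ∂ν =
      (∑ k ∈ Finset.range t, ∫ ω, ∑ b : Fin q → α, (∏ j, ν.real (X 0 ⁻¹' {b j})) *
        ((φ (pastBlocks q (fun n => X n ω) k) b).map f).sum ∂ν) / ((t : ℝ) * (q : ℝ)) := by
  rw [integral_div]
  congr 1
  simp only [φ.sum_map_output]
  rw [integral_finsetSum _ fun k _ => integrable_past_block hX q k
    (fun h b => ((φ h b).map f).sum)]
  exact Finset.sum_congr rfl fun k _ => integral_past_block hX hind hid q k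
    (fun h b => ((φ h b).map f).sum)

lemma sum_measureReal_eq_one (hX : Measurable (X 0)) : ∑ x, ν.real (X 0 ⁻¹' {x}) = 1 := by
  have := integral_eq_sum_of_indepFun (ν := ν) (A := fun _ : Ω => ()) (B := X 0) measurable_const hX
    (indepFun_const_left () _) (fun _ _ => 1)
  simpa using this.symm

/-- Codes whose average over a block does not depend on the past. -/
lemma hasAverageCost_of_forall {β : Type} (hX : ∀ n, Measurable (X n)) (hind : iIndepFun X ν)
    (hid : ∀ n, IdentDistrib (X n) (X 0) ν ν) {q : ℕ} (hq : 0 < q) (φ : ShapingEncoder q α β)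
    (f : β → ℝ) (C : ℝ)
    (h : ∀ l, ∑ b : Fin q → α, (∏ j, ν.real (X 0 ⁻¹' {b j})) * ((φ l b).map f).sum = q * C) :
    φ.HasAverageCost ν X f C := by
  unfold ShapingEncoder.HasAverageCost
  simp only [integral_output_eq hX hind hid φ f, h]
  refine tendsto_const_nhds.congr' ?_
  filter_upwards [eventually_gt_atTop 0] with t ht
  have h1 : (t : ℝ) ≠ 0 := by positivity
  have h2 : (q : ℝ) ≠ 0 := by positivity
  simp
  field_simp

/-- The lower bound on the average cost of a prefix-free code, for an additive functional `f` of
the output such that `exp (-f)` satisfies Kraft's inequality. -/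
lemma entropy_le_of_hasAverageCost {β : Type} [Fintype β] [DecidableEq α] [DecidableEq β]
    (hX : ∀ n, Measurable (X n))
    (hind : iIndepFun X ν) (hid : ∀ n, IdentDistrib (X n) (X 0) ν ν)
    (hpos : ∀ x, 0 < ν.real (X 0 ⁻¹' {x})) {q : ℕ} (hq : 0 < q) (φ : ShapingEncoder q α β)
    (hφ : φ.PrefixFree) (f : β → ℝ) (hf : ∑ a, Real.exp (-f a) ≤ 1) (C : ℝ)
    (hC : φ.HasAverageCost ν X f C) :
    ∑ x, ν.real (X 0 ⁻¹' {x}) * -Real.log (ν.real (X 0 ⁻¹' {x})) ≤ C := by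
  set p : α → ℝ := fun x => ν.real (X 0 ⁻¹' {x}) with hp
  have hp1 : ∑ x, p x = 1 := sum_measureReal_eq_one (hX 0)
  set E := ∑ x, p x * -Real.log (p x) with hE
  -- For a fixed history the weights `exp (-f)` of the codewords form a subprobability on blocks;
  -- Gibbs' inequality compares it with the product distribution, whose entropy is `q * E`.
  have hblock : ∀ l, q * E ≤ ∑ b : Fin q → α, (∏ j, p (b j)) * ((φ l b).map f).sum := by
    intro l
    have hexp : ∀ s : List β, (s.map fun a => Real.exp (-f a)).prod = Real.exp (-(s.map f).sum) := by
      intro s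
      induction s with
      | nil => simp
      | cons a s ih => simp [ih, Real.exp_add, add_comm]
    have hk := sum_prod_weight_le_one_of_prefixFree (Q := fun a => Real.exp (-f a))
      (fun a => (Real.exp_pos _).le) hf (Finset.univ.sup fun b => (φ l b).length) Finset.univ
      (φ l) (fun i _ j _ h => hφ l i j h)
      (fun i hi => Finset.le_sup (f := fun b => (φ l b).length) hi)
    simp only [hexp] at hk
    have hg := sum_mul_log_le_sum_mul_log (p := fun b : Fin q → α => ∏ j, p (b j))
      (fun b => Finset.prod_pos fun j _ => hpos _) (sum_prod_eq_one hp1 q)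
      (fun b => Real.exp_pos _) hk
    simp only [Real.log_exp] at hg
    have h1 : ∀ b : Fin q → α, Real.log (∏ j, p (b j)) = -∑ j, -Real.log (p (b j)) := by
      intro b
      rw [Real.log_prod fun j _ => (hpos _).ne']
      simp [hp]
    simp only [h1, mul_neg, Finset.sum_neg_distrib] at hg
    have h2 := sum_prod_mul_sum hp1 (fun x => -Real.log (p x)) q
    simp only [Finset.sum_neg_distrib, mul_neg] at h2
    simp only [hE, mul_neg, Finset.sum_neg_distrib]
    linarith
  refine ge_of_tendsto hC ?_
  filter_upwards [eventually_gt_atTop 0] with t ht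
  rw [integral_output_eq hX hind hid, le_div_iff₀ (by positivity)]
  have hint : ∀ k, q * E ≤ ∫ ω, ∑ b : Fin q → α, (∏ j, p (b j)) *
        ((φ (pastBlocks q (fun n => X n ω) k) b).map f).sum ∂ν := by
    intro k
    have := integral_mono (μ := ν) (integrable_const (q * E)) (integrable_past_block hX q k
      (fun l _ => ∑ b : Fin q → α, (∏ j, p (b j)) * ((φ l b).map f).sum))
      (fun ω => hblock (pastBlocks q (fun n => X n ω) k))
    simpa using this
  calc E * (t * q) = ∑ k ∈ Finset.range t, q * E := by simp; ring
    _ ≤ _ := Finset.sum_le_sum fun k _ => hint k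

end Source

/-! ### The direct shaping code -/

lemma directShapingCode_prefixFree {m : ℕ} (y : Fin (2 ^ m) ≃ Word m) :
    (directShapingCode y).PrefixFree := by
  intro h b b' hbb
  obtain ⟨d, -, hd⟩ := directShapingCode_eq y h
  rw [hd, hd] at hbb
  have := hbb.eq_of_length rfl
  simp only [List.cons.injEq, and_true, EmbeddingLike.apply_eq_iff_eq] at this
  funext j
  rwa [Subsingleton.elim j 0]

lemma directShapingCode_sum {m : ℕ} (y : Fin (2 ^ m) ≃ Word m) (p f : Word m → ℝ)
    (h : List (Fin 1 → Word m)) :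
    ∃ d : Fin (2 ^ m) ≃ Word m, (∀ i j, i ≤ j → wordCount h (d j) ≤ wordCount h (d i)) ∧
      ∑ b : Fin 1 → Word m, (∏ j, p (b j)) * ((directShapingCode y h b).map f).sum =
        ∑ k, p (d k) * f (y k) := by
  obtain ⟨d, hd, hdc⟩ := directShapingCode_eq y h
  refine ⟨d, hd, ?_⟩
  rw [← (d.trans (Equiv.funUnique (Fin 1) (Word m)).symm).sum_comp]
  simp [hdc]

lemma wordCount_pastBlocks {m : ℕ} (x : ℕ → Word m) (v : Word m) (k : ℕ) :
    (wordCount (pastBlocks 1 x k) v : ℝ) =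
      ∑ i ∈ Finset.range k, ({v} : Set (Word m)).indicator (fun _ => (1 : ℝ)) (x i) := by
  induction k with
  | zero => simp [pastBlocks, wordCount]
  | succ k ih =>
    rw [Finset.sum_range_succ, ← ih]
    by_cases hv : x k = v
    · simp [pastBlocks, wordCount, List.range_succ, block, hv]
    · simp [pastBlocks, wordCount, List.range_succ, block, hv]

section Source

variable {Ω : Type*} [MeasurableSpace Ω] {ν : Measure Ω} [IsProbabilityMeasure ν] {m : ℕ}
  {X : ℕ → Ω → Word m}

lemma ae_tendsto_wordCount (hX : ∀ n, Measurable (X n)) (hind : iIndepFun X ν)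
    (hid : ∀ n, IdentDistrib (X n) (X 0) ν ν) (v : Word m) :
    ∀ᵐ ω ∂ν, Tendsto (fun k : ℕ => (wordCount (pastBlocks 1 (fun n => X n ω) k) v : ℝ) / k) atTop
      (𝓝 (ν.real (X 0 ⁻¹' {v}))) := by
  set f : Word m → ℝ := ({v} : Set (Word m)).indicator fun _ => 1
  have hf : Measurable f := measurable_of_finite _
  have h := strong_law_ae_real (μ := ν) (fun n ω => f (X n ω)) (integrable_comp_of_finite (hX 0) f)
    (fun i j hij => (hind.indepFun hij).comp hf hf) (fun n => (hid n).comp hf)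
  have hint : ∫ ω, f (X 0 ω) ∂ν = ν.real (X 0 ⁻¹' {v}) := by
    have : (fun ω => f (X 0 ω)) = (X 0 ⁻¹' {v}).indicator fun _ => (1 : ℝ) := by
      ext ω; simp [f, Set.indicator, Pi.single_apply]
    rw [this, integral_indicator_const _ (hX 0 (measurableSet_singleton v))]
    simp
  filter_upwards [h] with ω hω
  simpa only [wordCount_pastBlocks, hint] using hω

/-- Almost surely the conditional cost given the past is eventually equal to the limit. Dominated
convergence carries this to expectations, and the average over the first `t` blocks is a Cesàro
mean. -/
lemma directShapingCode_hasAverageCost (hX : ∀ n, Measurable (X n)) (hind : iIndepFun X ν)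
    (hid : ∀ n, IdentDistrib (X n) (X 0) ν ν) (w y : Fin (2 ^ m) ≃ Word m)
    (hw : Antitone fun i => ν.real (X 0 ⁻¹' {w i})) :
    (directShapingCode y).HasAverageCost ν X slcCost
      (∑ i, ν.real (X 0 ⁻¹' {w i}) * slcCost (y i)) := by
  set p : Word m → ℝ := fun x => ν.real (X 0 ⁻¹' {x})
  set C := ∑ i, p (w i) * slcCost (y i)
  set F : List (Fin 1 → Word m) → ℝ := fun h =>
    ∑ b : Fin 1 → Word m, (∏ j, p (b j)) * ((directShapingCode y h b).map slcCost).sum with hF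
  have hbound : ∀ h, |F h| ≤ ∑ _k : Fin (2 ^ m), (m : ℝ) := by
    intro h
    obtain ⟨d, -, hd⟩ := directShapingCode_sum y p slcCost h
    simp only [hF]
    rw [hd]
    refine (Finset.abs_sum_le_sum_abs _ _).trans (Finset.sum_le_sum fun k _ => ?_)
    rw [abs_of_nonneg (mul_nonneg measureReal_nonneg (slcCost_nonneg _))]
    exact (mul_le_of_le_one_left (slcCost_nonneg _) measureReal_le_one).trans (slcCost_le _)
  have hlim : ∀ᵐ ω ∂ν, Tendsto (fun k => F (pastBlocks 1 (fun n => X n ω) k)) atTop (𝓝 C) := by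
    filter_upwards [ae_all_iff.2 fun v => ae_tendsto_wordCount hX hind hid v] with ω hω
    -- There are finitely many pairs of words, so one threshold serves them all.
    have hev : ∀ᶠ k in atTop, ∀ u v : Word m, p u < p v →
        wordCount (pastBlocks 1 (fun n => X n ω) k) u <
          wordCount (pastBlocks 1 (fun n => X n ω) k) v := by
      refine eventually_all.2 fun u => eventually_all.2 fun v => ?_
      by_cases huv : p u < p v
      · filter_upwards [(hω u).eventually_lt (hω v) huv, eventually_gt_atTop 0] with k hk hk0 _
        rw [div_lt_div_iff_of_pos_right (by positivity)] at hk
        exact_mod_cast hk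
      · exact Eventually.of_forall fun k h => absurd h huv
    refine tendsto_const_nhds.congr' ?_
    filter_upwards [hev] with k hk
    obtain ⟨d, hda, hd⟩ := directShapingCode_sum y p slcCost (pastBlocks 1 (fun n => X n ω) k)
    simp only [hF]
    rw [hd]
    have hanti : Antitone ((fun i => p (w i)) ∘ (d.trans w.symm)) := by
      intro i j hij
      simp only [Function.comp_apply, Equiv.trans_apply, Equiv.apply_symm_apply]
      by_contra hlt
      exact absurd (hda i j hij) (not_le.2 (hk _ _ (not_le.1 hlt)))
    -- Words of equal probability may stay in any order, but two non-increasing arrangements of the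
    -- same probabilities agree as sequences.
    have huniq := Tuple.unique_antitone (τ := Equiv.refl _) hanti (by simpa using hw)
    refine Finset.sum_congr rfl fun i _ => ?_
    have := congrFun huniq i
    simp only [Function.comp_apply, Equiv.trans_apply, Equiv.apply_symm_apply,
      Equiv.refl_apply] at this
    rw [this]
  have hE : Tendsto (fun k => ∫ ω, F (pastBlocks 1 (fun n => X n ω) k) ∂ν) atTop (𝓝 C) := by
    have := tendsto_integral_of_dominated_convergence (μ := ν)
      (F := fun k ω => F (pastBlocks 1 (fun n => X n ω) k)) (f := fun _ => C)
      (fun _ => ∑ _k : Fin (2 ^ m), (m : ℝ))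
      (fun k => (integrable_past_block hX 1 k (fun h _ => F h)).aestronglyMeasurable)
      (integrable_const _) (fun k => Eventually.of_forall fun ω => hbound _) hlim
    simpa using this
  unfold ShapingEncoder.HasAverageCost
  simp only [integral_output_eq hX hind hid]
  refine hE.cesaro.congr fun t => ?_
  simp only [Nat.cast_one, mul_one, hF, div_eq_inv_mul]
  rfl

lemma directShapingCode_isRateOne (hX : ∀ n, Measurable (X n)) (hind : iIndepFun X ν)
    (hid : ∀ n, IdentDistrib (X n) (X 0) ν ν) (y : Fin (2 ^ m) ≃ Word m) :
    (directShapingCode y).IsRateOne ν X := by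
  refine ⟨one_pos, directShapingCode_prefixFree y, ?_⟩
  rw [ShapingEncoder.hasExpansionFactor_iff]
  refine hasAverageCost_of_forall hX hind hid one_pos _ _ _ fun l => ?_
  obtain ⟨d, -, hd⟩ := directShapingCode_sum y (fun x => ν.real (X 0 ⁻¹' {x})) (fun _ => 1) l
  rw [hd]
  simp only [mul_one, Nat.cast_one]
  rw [d.sum_comp fun x => ν.real (X 0 ⁻¹' {x})]
  exact sum_measureReal_eq_one (hX 0)

/-- The average cost of a rate-1 code is at least that of a Gibbs distribution which is the
distribution of the source. -/
lemma gibbs_le_of_isRateOne (hX : ∀ n, Measurable (X n)) (hind : iIndepFun X ν)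
    (hid : ∀ n, IdentDistrib (X n) (X 0) ν ν) (w y : Fin (2 ^ m) ≃ Word m) {r : ℝ} (hr : 0 ≤ r)
    (hP : ∀ i, ν.real (X 0 ⁻¹' {w i}) =
      Real.exp (-(r * slcCost (y i))) / ∑ j, Real.exp (-(r * slcCost (y j))))
    {q : ℕ} {ψ : ShapingEncoder q (Word m) (Word m)} {C : ℝ} (hψ : ψ.IsRateOne ν X)
    (hC : ψ.HasAverageCost ν X slcCost C) :
    ∑ i, ν.real (X 0 ⁻¹' {w i}) * slcCost (y i) ≤ C := by
  set p : Word m → ℝ := fun x => ν.real (X 0 ⁻¹' {x})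
  set Z : ℝ → ℝ := fun s => ∑ j, Real.exp (-(s * slcCost (y j))) with hZdef
  have hZ : ∀ s, 0 < Z s := fun s => Finset.sum_pos (fun j _ => Real.exp_pos _) ⟨⟨0, by simp⟩, by simp⟩
  have hp1 : ∑ i, p (w i) = 1 := by
    rw [w.sum_comp p]; exact sum_measureReal_eq_one (hX 0)
  have hpos : ∀ x, 0 < p x := by
    intro x
    obtain ⟨i, rfl⟩ := w.surjective x
    simp only [p, hP]
    exact div_pos (Real.exp_pos _) (hZ r)
  -- With the constant `log (Z s)` per letter the Kraft sum is exactly 1; rate 1 makes these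
  -- constants contribute `log (Z s)` per source symbol.
  have hbound : ∀ s, ∑ i, p (w i) * -Real.log (p (w i)) ≤ s * C + Real.log (Z s) := by
    intro s
    have hone := (ShapingEncoder.hasExpansionFactor_iff ψ 1).1 hψ.2.2
    have := entropy_le_of_hasAverageCost hX hind hid hpos hψ.1 ψ hψ.2.1
      (fun a => s * slcCost a + Real.log (Z s) * 1) ?_ _
      (hC.linear_combination hX hone s (Real.log (Z s)))
    · rw [w.sum_comp fun x => p x * -Real.log (p x)]
      simpa using this
    · simp only [mul_one, neg_add, Real.exp_add, Real.exp_neg (Real.log _), Real.exp_log (hZ s)]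
      rw [← Finset.sum_mul, ← y.sum_comp]
      exact (mul_inv_cancel₀ (hZ s).ne').le
  have hent : ∑ i, p (w i) * -Real.log (p (w i)) =
      r * ∑ i, p (w i) * slcCost (y i) + Real.log (Z r) := by
    have : ∀ i, p (w i) * -Real.log (p (w i)) =
        r * (p (w i) * slcCost (y i)) + p (w i) * Real.log (Z r) := by
      intro i
      have h1 : Real.log (p (w i)) = -(r * slcCost (y i)) - Real.log (Z r) := by
        simp only [p, hP]
        rw [Real.log_div (Real.exp_pos _).ne' (hZ r).ne', Real.log_exp]
      rw [h1]; ring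
    simp only [this, Finset.sum_add_distrib, ← Finset.mul_sum, ← Finset.sum_mul, hp1, one_mul]
  rcases hr.eq_or_lt with rfl | hr
  -- At `s = 0` the bound says nothing about `C`, so a small `s > 0` is used and `log (Z s)` is
  -- expanded to first order with a quadratic error.
  · have hN : Z 0 = 2 ^ m := by simp [hZdef]
    have hNpos : (0 : ℝ) < 2 ^ m := by positivity
    have hpw : ∀ i, p (w i) = (2 ^ m : ℝ)⁻¹ := fun i => by
      simp only [p, hP, ← hN, hZdef]; simp
    simp only [hent, hN, zero_mul, zero_add] at hbound
    -- Costs are at most `m`, so `s * m ≤ 1` puts every exponent in the range of the quadratic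
    -- estimate for `exp`.
    have hquad : ∀ s : ℝ, 0 < s → s * m ≤ 1 →
        ∑ i, p (w i) * slcCost (y i) ≤ C + s * ∑ i, p (w i) * slcCost (y i) ^ 2 := by
      intro s hs hsm
      have h1 : Real.log (Z s / 2 ^ m) ≤ Z s / 2 ^ m - 1 :=
        Real.log_le_sub_one_of_pos (div_pos (hZ s) hNpos)
      rw [Real.log_div (hZ s).ne' hNpos.ne'] at h1
      have h2 : Z s / 2 ^ m = ∑ i, p (w i) * Real.exp (-(s * slcCost (y i))) := by
        simp only [hpw, ← Finset.mul_sum, hZdef]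
        rw [div_eq_inv_mul]
      have h3 : ∀ i, p (w i) * Real.exp (-(s * slcCost (y i))) ≤
          p (w i) - s * (p (w i) * slcCost (y i)) + s ^ 2 * (p (w i) * slcCost (y i) ^ 2) := by
        intro i
        have hle : s * slcCost (y i) ≤ 1 :=
          (mul_le_mul_of_nonneg_left (slcCost_le _) hs.le).trans hsm
        have h0 : 0 ≤ s * slcCost (y i) := mul_nonneg hs.le (slcCost_nonneg _)
        have h4 := (abs_le.1 (Real.abs_exp_sub_one_sub_id_le (x := -(s * slcCost (y i)))
          (by rw [abs_neg, abs_of_nonneg h0]; exact hle))).2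
        have h5 := mul_le_mul_of_nonneg_left h4 (hpos (w i)).le
        nlinarith [h5]
      have h6 := Finset.sum_le_sum fun i (_ : i ∈ Finset.univ) => h3 i
      simp only [Finset.sum_add_distrib, Finset.sum_sub_distrib, ← Finset.mul_sum, hp1] at h6
      have h7 := hbound s
      rw [h2] at h1
      have h8 : s * ∑ i, p (w i) * slcCost (y i) ≤
          s * (C + s * ∑ i, p (w i) * slcCost (y i) ^ 2) := by
        rw [mul_add, ← mul_assoc, ← sq]
        linarith
      exact le_of_mul_le_mul_left h8 hs
    have hlim : Tendsto (fun s : ℝ => C + s * ∑ i, p (w i) * slcCost (y i) ^ 2) (𝓝[>] 0) (𝓝 C) := by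
      have : Tendsto (fun s : ℝ => C + s * ∑ i, p (w i) * slcCost (y i) ^ 2) (𝓝 0)
          (𝓝 (C + 0 * ∑ i, p (w i) * slcCost (y i) ^ 2)) :=
        Continuous.tendsto (by fun_prop) 0
      simpa using this.mono_left nhdsWithin_le_nhds
    refine ge_of_tendsto hlim ?_
    have hm : ∀ᶠ s : ℝ in 𝓝[>] 0, s < 1 / (m + 1) :=
      nhdsWithin_le_nhds (gt_mem_nhds (by positivity))
    filter_upwards [self_mem_nhdsWithin, hm] with s hs hsm
    refine hquad s hs ?_
    rw [lt_div_iff₀ (by positivity)] at hsm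
    have : (0 : ℝ) < s := hs
    linarith
  · have := hbound r
    rw [hent] at this
    exact le_of_mul_le_mul_left (by linarith) hr

end Source

/-! ### Exchanging two codewords of a block code -/

lemma sum_mul_swap {ι : Type} [Fintype ι] [DecidableEq ι] (p F : ι → ℝ) (I J : ι) :
    ∑ b, p b * F (Equiv.swap I J b) = ∑ b, p b * F b + (p I - p J) * (F J - F I) := by
  rcases eq_or_ne I J with rfl | hIJ
  · simp
  · rw [← sub_eq_iff_eq_add', ← Finset.sum_sub_distrib, Fintype.sum_eq_add I J hIJ]
    · rw [Equiv.swap_apply_left, Equiv.swap_apply_right]; ring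
    · rintro b ⟨h1, h2⟩
      rw [Equiv.swap_apply_of_ne_of_ne h1 h2, sub_self]

section Source

variable {Ω : Type*} [MeasurableSpace Ω] {ν : Measure Ω} [IsProbabilityMeasure ν] {m : ℕ}
  {X : ℕ → Ω → Word m}

/-- If no block code beats the letterwise code, then the more probable blocks have the smaller
costs. -/
lemma cost_le_of_prob_lt (hX : ∀ n, Measurable (X n)) (hind : iIndepFun X ν)
    (hid : ∀ n, IdentDistrib (X n) (X 0) ν ν) (e : Word m ≃ Word m) {q : ℕ} (hq : 0 < q)
    (hopt : ∀ (ψ : ShapingEncoder q (Word m) (Word m)) (C : ℝ), ψ.IsRateOne ν X →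
      ψ.HasAverageCost ν X slcCost C → ∑ x, ν.real (X 0 ⁻¹' {x}) * slcCost (e x) ≤ C)
    (I J : Fin q → Word m)
    (hIJ : ∏ j, ν.real (X 0 ⁻¹' {J j}) < ∏ j, ν.real (X 0 ⁻¹' {I j})) :
    ∑ j, slcCost (e (I j)) ≤ ∑ j, slcCost (e (J j)) := by
  set p : Word m → ℝ := fun x => ν.real (X 0 ⁻¹' {x})
  have hp1 : ∑ x, p x = 1 := sum_measureReal_eq_one (hX 0)
  let F : (Fin q → Word m) → ℝ := fun b => ∑ j, slcCost (e (b j))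
  -- The letterwise code with the codewords of `I` and `J` exchanged; all codewords keep length `q`.
  let ψ : ShapingEncoder q (Word m) (Word m) := fun _ b =>
    List.ofFn fun j => e (Equiv.swap I J b j)
  have hq' : (q : ℝ) ≠ 0 := by positivity
  set S := ∑ b : Fin q → Word m, (∏ j, p (b j)) * F (Equiv.swap I J b) with hS
  have hrate : ψ.IsRateOne ν X := by
    refine ⟨hq, fun h b b' hbb => ?_, ?_⟩
    · have h1 := hbb.eq_of_length (by simp [ψ])
      have h2 := List.ofFn_injective h1
      refine (Equiv.swap I J).injective (funext fun j => e.injective (congrFun h2 j))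
    · rw [ShapingEncoder.hasExpansionFactor_iff]
      refine hasAverageCost_of_forall hX hind hid hq _ _ _ fun l => ?_
      simp only [ψ, List.map_const', List.length_ofFn, List.sum_replicate, nsmul_eq_mul, mul_one]
      rw [← Finset.sum_mul, sum_prod_eq_one hp1, one_mul]
  have hcost : ψ.HasAverageCost ν X slcCost (S / q) := by
    refine hasAverageCost_of_forall hX hind hid hq _ _ _ fun l => ?_
    rw [mul_div_cancel₀ _ hq', hS]
    refine Finset.sum_congr rfl fun b _ => ?_
    simp only [ψ, F, List.map_ofFn, List.sum_ofFn, Function.comp_apply]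
    rfl
  have h1 := hopt ψ _ hrate hcost
  rw [le_div_iff₀ (by positivity), mul_comm, ← sum_prod_mul_sum hp1, hS,
    sum_mul_swap (fun b : Fin q → Word m => ∏ j, p (b j)) F I J] at h1
  have h2 : 0 ≤ (∏ j, p (I j) - ∏ j, p (J j)) * (F J - F I) := by
    simp only [F] at h1 ⊢
    linarith
  have h3 := nonneg_of_mul_nonneg_right h2 (sub_pos.2 hIJ)
  simp only [F] at h3
  linarith

end Source

/-! ### Distributions that are ordered like the costs on all blocks -/

/-- In terms of `a i = log (P z / P i)`, `hex` says that the block with the smaller total `a` has no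
larger total cost. If `a` were not proportional to `c`, some comparison of many copies of `i` with
many copies of `L` would order `a` and `c` oppositely. The letter `z`, where both vanish, pads the
blocks to equal length. -/
lemma gibbs_of_exchange {N : ℕ} (P c : Fin N → ℝ) (z L : Fin N) (hP : ∀ i, 0 < P i)
    (hz : ∀ i, P i ≤ P z) (hcnat : ∀ i, ∃ n : ℕ, c i = n) (hcz : c z = 0)
    (hc0 : ∀ i, c i = 0 → i = z) (hL : 0 < c L)
    (hex : ∀ A B : ℕ, 0 < A + B → ∀ i j k l, P j ^ A * P l ^ B < P i ^ A * P k ^ B →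
      A * c i + B * c k ≤ A * c j + B * c l) :
    ∃ r : ℝ, 0 ≤ r ∧ ∀ i, P i = P z * Real.exp (-(r * c i)) := by
  set a : Fin N → ℝ := fun i => Real.log (P z) - Real.log (P i)
  have ha : ∀ i, 0 ≤ a i := fun i => sub_nonneg.2 (Real.log_le_log (hP i) (hz i))
  have hlog : ∀ (A B : ℕ) (i j k l : Fin N), A * a i + B * a k < A * a j + B * a l →
      P j ^ A * P l ^ B < P i ^ A * P k ^ B := by
    intro A B i j k l h
    have hpos : ∀ i k, 0 < P i ^ A * P k ^ B := fun i k =>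
      mul_pos (pow_pos (hP i) A) (pow_pos (hP k) B)
    have hl : ∀ i k, Real.log (P i ^ A * P k ^ B) =
        (A + B) * Real.log (P z) - (A * a i + B * a k) := by
      intro i k
      rw [Real.log_mul (pow_pos (hP i) A).ne' (pow_pos (hP k) B).ne', Real.log_pow, Real.log_pow]
      simp only [a]
      ring
    refine (Real.log_lt_log_iff (hpos _ _) (hpos _ _)).1 ?_
    rw [hl, hl]
    linarith
  have haz : a z = 0 := sub_self _
  have key : ∀ i, c L * a i = c i * a L := by
    intro i
    obtain ⟨M, hM⟩ := hcnat L
    obtain ⟨n, hn⟩ := hcnat i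
    have hM0 : (0 : ℝ) < M := hM ▸ hL
    have hM0' : 0 < M := by exact_mod_cast hM0
    rw [hM, hn]
    refine le_antisymm ?_ ?_
    · by_contra! hlt
      -- Choose `k` so large that `n * k + 1` copies of `L` still have smaller total `a` than `M *
      -- k` copies of `i`, though they cost `M` more.
      obtain ⟨k, hk⟩ := exists_nat_gt (a L / (M * a i - n * a L))
      rw [div_lt_iff₀ (sub_pos.2 hlt)] at hk
      have hk0 : 0 < k := by
        rcases Nat.eq_zero_or_pos k with rfl | h
        · have := ha L
          simp at hk
          linarith
        · exact h
      have h := hex (M * k) (n * k + 1) (by positivity) z i L z (hlog _ _ _ _ _ _ (by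
        rw [haz]; push_cast; linarith))
      rw [hcz, hM, hn] at h
      push_cast at h
      linarith
    · by_contra! hlt
      rcases Nat.eq_zero_or_pos n with rfl | hn0
      · rw [hc0 i (by simpa using hn), haz] at hlt
        simp at hlt
      obtain ⟨k, hk⟩ := exists_nat_gt (a L / (n * a L - M * a i))
      rw [div_lt_iff₀ (sub_pos.2 hlt)] at hk
      have hk0 : 0 < k := by
        rcases Nat.eq_zero_or_pos k with rfl | h
        · have := ha L
          simp at hk
          linarith
        · exact h
      -- Symmetrically, `n * k - 1` copies of `L` have larger total `a` than `M * k` copies of `i`,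
      -- though they cost `M` less.
      obtain ⟨B, hB⟩ : ∃ B, n * k = B + 1 := Nat.exists_eq_add_one.2 (by positivity)
      have hB' : (n : ℝ) * k = B + 1 := by exact_mod_cast hB
      have h := hex (M * k) B (by positivity) i z z L (hlog _ _ _ _ _ _ (by
        rw [haz]; push_cast; linarith [congrArg (· * a L) hB']))
      rw [hcz, hM, hn] at h
      push_cast at h
      linarith [congrArg (· * (M : ℝ)) hB']
  refine ⟨a L / c L, div_nonneg (ha L) hL.le, fun i => ?_⟩
  have h1 : a L / c L * c i = a i := by
    rw [div_mul_eq_mul_div, div_eq_iff hL.ne', mul_comm (a L), ← key, mul_comm]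
  rw [h1]
  simp only [a, neg_sub]
  rw [Real.exp_sub, Real.exp_log (hP i), Real.exp_log (hP z), mul_div_cancel₀ _ (hP z).ne']

/-! ### The characterisation of optimality -/

theorem mainTheorem6 {Ω : Type*} [MeasurableSpace Ω] (ν : Measure Ω) [IsProbabilityMeasure ν]
    (m : ℕ)
    -- the i.i.d. source of words of length `m`
    (X : ℕ → Ω → Word m) (hX_meas : ∀ n, Measurable (X n)) (hX_indep : iIndepFun X ν)
    (hX_ident : ∀ n, IdentDistrib (X n) (X 0) ν ν)
    -- the input words `w i` by non-increasing probability `P i`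
    (w : Fin (2 ^ m) ≃ Word m) (P : Fin (2 ^ m) → ℝ)
    (hP : ∀ i, P i = ν.real (X 0 ⁻¹' {w i})) (hP_anti : Antitone P)
    -- the output list `y i` by non-decreasing cost `c i`
    (y : Fin (2 ^ m) ≃ Word m) (c : Fin (2 ^ m) → ℝ)
    (hc : ∀ i, c i = slcCost (y i)) (hc_mono : Monotone c)
    (H : ℝ) (hH : entropyBits P = H) (hH_pos : 0 < H) :
    (directShapingCode y).IsOptimalRateOne ν X slcCost ↔
      ∃ μ : ℝ, 0 ≤ μ ∧
        (∀ i, P i = (2 : ℝ) ^ (-μ * c i) / ∑ j, (2 : ℝ) ^ (-μ * c j)) ∧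
        entropyBits P = H := by
  have hw : Antitone fun i => ν.real (X 0 ⁻¹' {w i}) := by simpa only [← hP] using hP_anti
  have hdir := directShapingCode_hasAverageCost hX_meas hX_indep hX_ident w y hw
  have hexp : ∀ μ t : ℝ, (2 : ℝ) ^ (-μ * t) = Real.exp (-(Real.log 2 * μ * t)) := by
    intro μ t
    rw [Real.rpow_def_of_pos two_pos]
    ring_nf
  have hlog2 : 0 < Real.log 2 := Real.log_pos one_lt_two
  have hP1 : ∑ i, P i = 1 := by
    simp only [hP]
    rw [w.sum_comp fun x => ν.real (X 0 ⁻¹' {x})]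
    exact sum_measureReal_eq_one (hX_meas 0)
  have hP0 : ∀ i, 0 ≤ P i := fun i => by rw [hP]; exact measureReal_nonneg
  constructor
  · rintro ⟨-, C, hC, hopt⟩
    obtain rfl := tendsto_nhds_unique hC hdir
    let e : Word m ≃ Word m := w.symm.trans y
    have hCe : ∑ i, ν.real (X 0 ⁻¹' {w i}) * slcCost (y i) =
        ∑ x, ν.real (X 0 ⁻¹' {x}) * slcCost (e x) := by
      rw [← w.sum_comp]
      simp [e]
    rw [hCe] at hopt
    have hex : ∀ A B : ℕ, 0 < A + B → ∀ i j k l, P j ^ A * P l ^ B < P i ^ A * P k ^ B →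
        A * c i + B * c k ≤ A * c j + B * c l := by
      intro A B hAB i j k l h
      have := cost_le_of_prob_lt hX_meas hX_indep hX_ident e hAB (hopt _)
        (Fin.append (fun _ : Fin A => w i) (fun _ : Fin B => w k))
        (Fin.append (fun _ : Fin A => w j) (fun _ : Fin B => w l))
        (by simpa [Fin.prod_univ_add, ← hP] using h)
      simpa [Fin.sum_univ_add, e, ← hc] using this
    let z : Fin (2 ^ m) := ⟨0, by simp⟩
    have hzle : ∀ i, z ≤ i := fun i => Nat.zero_le _
    have hc_nonneg : ∀ i, 0 ≤ c i := fun i => by rw [hc]; exact slcCost_nonneg _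
    have hcz : c z = 0 := by
      refine le_antisymm ((hc_mono (hzle (y.symm fun _ => true))).trans ?_) (hc_nonneg z)
      rw [hc, Equiv.apply_symm_apply, (slcCost_eq_zero_iff _).2 rfl]
    have hc0 : ∀ i, c i = 0 → i = z := by
      intro i hi
      rw [hc, slcCost_eq_zero_iff] at hi hcz
      exact y.injective (hi.trans hcz.symm)
    -- Otherwise the source is a point mass at `w z`, of entropy 0.
    obtain ⟨i₁, hi₁z, hi₁⟩ : ∃ i, i ≠ z ∧ 0 < P i := by
      by_contra! hall
      have h0 : ∀ i, i ≠ z → P i = 0 := fun i hi => le_antisymm (hall i hi) (hP0 i)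
      have hz1 : P z = 1 := by
        rw [← hP1, Finset.sum_eq_single z (fun i _ hi => h0 i hi) (by simp)]
      rw [← hH, entropyBits, Finset.sum_eq_single z (fun i _ hi => by rw [h0 i hi, zero_mul])
        (by simp), hz1] at hH_pos
      simp at hH_pos
    have hPz : 0 < P z := hi₁.trans_le (hP_anti (hzle i₁))
    have hc₁ : 0 < c i₁ := (hc_nonneg _).lt_of_ne fun h => hi₁z (hc0 _ h.symm)
    have hpos : ∀ j, 0 < P j := by
      intro j
      by_contra hj
      have hj0 : P j = 0 := le_antisymm (not_lt.1 hj) (hP0 j)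
      obtain ⟨n, hn⟩ := exists_nat_gt (c j / c i₁)
      rw [div_lt_iff₀ hc₁] at hn
      -- The block of `n` letters `z` and one letter `j` has probability 0, so it must cost at least
      -- as much as `n + 1` letters `i₁`; the choice of `n` prevents this.
      have := hex n 1 (by omega) i₁ z i₁ j (by rw [hj0]; simp; positivity)
      rw [hcz] at this
      push_cast at this
      linarith
    obtain ⟨r, hr, hPr⟩ := gibbs_of_exchange P c z i₁ hpos (fun i => hP_anti (hzle i))
      (fun i => ⟨_, hc i⟩) hcz hc0 hc₁ hex
    -- Conversion from base `e` to base 2.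
    have hr2 : Real.log 2 * (r / Real.log 2) = r := mul_div_cancel₀ _ hlog2.ne'
    refine ⟨r / Real.log 2, div_nonneg hr hlog2.le, fun i => ?_, hH⟩
    simp only [hexp, hr2]
    have hsum : P z * ∑ j, Real.exp (-(r * c j)) = 1 := by
      rw [Finset.mul_sum, ← hP1]
      exact Finset.sum_congr rfl fun j _ => (hPr j).symm
    rw [eq_div_iff (right_ne_zero_of_mul_eq_one hsum), hPr i]
    linear_combination Real.exp (-(r * c i)) * hsum
  · rintro ⟨μ, hμ, hPμ, -⟩
    refine ⟨directShapingCode_isRateOne hX_meas hX_indep hX_ident y, _, hdir,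
      fun q ψ C hψ hC => ?_⟩
    refine gibbs_le_of_isRateOne hX_meas hX_indep hX_ident w y (mul_nonneg hlog2.le hμ) ?_ hψ hC
    intro i
    rw [← hP, hPμ]
    simp only [hexp, hc]
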